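/- Let $n\ge 3$, let $R=\mathbb C[x_1,\dots,x_n,y_1,\dots,y_n]$ be the coordinate ring of $\mathbb C^{2n}$, and for $1\le i,j\le n$ let $\Delta_{ij}=x_iy_j-x_jy_i$ be the $2\times 2$ minors of the generic matrix with rows $(x_1,\dots,x_n)$ and $(y_1,\dots,y_n)$. Let $$f=\prod_{1\le i<j\le n}\Delta_{ij},$$ the defining polynomial of the determinantal arrangement of the complete graph on $n$ vertices, and let $\mathrm{Der}(-\log f)$ be the $R$-module of all $\mathbb C$-derivations $\theta:R\to R$ with $\theta(f)\in (f)$. Then $f$ is a free divisor, that is, $f\neq 0$ and $\mathrm{Der}(-\log f)$ is a free $R$-module. More precisely, put $$\alpha=\sum_{k=1}^n x_k\frac{\partial}{\partial y_k},\qquad \beta=\sum_{k=1}^n y_k\frac{\partial}{\partial x_k},\qquad \gamma=\sum_{k=1}^n y_k\frac{\partial}{\partial y_k},\qquad \theta_k=x_k\frac{\partial}{\partial x_k}+y_k\frac{\partial}{\partial y_k}\quad(1\le k\le n),$$ and, for $0\le m\le n-4$, $$\varphi_m=\sum_{k=4}^n a_{m,k}\,\Delta_{2k}\Delta_{3k}\Big(x_1\frac{\partial}{\partial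 x_k}+y_1\frac{\partial}{\partial y_k}\Big),\qquad a_{m,k}=\sum_{\substack{S\subseteq T_k\\ |S|=m}}\ \prod_{j\in S}x_j\prod_{j\in T_k\setminus S}y_j,\qquad T_k=\{4,\dots,n\}\setminus\{k\}$$ (there is no $\varphi_m$ if $n=3$). Then the $2n$ derivations $\alpha,\beta,\gamma,\theta_1,\dots,\theta_n,\varphi_0,\dots,\varphi_{n-4}$ form a basis of the $R$-module $\mathrm{Der}(-\log f)$. The coefficients of $\alpha,\beta,\gamma$ and the $\theta_k$ are homogeneous of degree $1$, those of the $\varphi_m$ are homogeneous of degree $n+1$, and the determinant of the $2n\times 2n$ matrix of coefficients of these derivations with respect to the $\partial/\partial x_i$, $\partial/\partial y_i$, taken in some order, equals $c\,f$ for a nonzero constant $c\in\mathbb C$. -/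

import Mathlib

noncomputable section

namespace DetArr

/-- The coordinate ring `ℂ[x₁, …, xₙ, y₁, …, yₙ]` of `ℂ²ⁿ`; the left summand indexes the `xᵢ`,
the right one the `yᵢ`. Columns are numbered from `0`. -/
abbrev CoordRing (n : ℕ) : Type := MvPolynomial (Fin n ⊕ Fin n) ℂ

/-- The `R`-module of polynomial vector fields on `ℂ²ⁿ`. -/
abbrev VectorField (n : ℕ) : Type := Derivation ℂ (CoordRing n) (CoordRing n)

variable {n : ℕ}

/-- The entry `xᵢ` of the generic `2 × n` matrix. -/
def x (i : Fin n) : CoordRing n := MvPolynomial.X (Sum.inl i)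

/-- The entry `yᵢ` of the generic `2 × n` matrix. -/
def y (i : Fin n) : CoordRing n := MvPolynomial.X (Sum.inr i)

/-- The vector field `∂/∂xᵢ`. -/
def dx (i : Fin n) : VectorField n := MvPolynomial.pderiv (Sum.inl i)

/-- The vector field `∂/∂yᵢ`. -/
def dy (i : Fin n) : VectorField n := MvPolynomial.pderiv (Sum.inr i)

/-- The generic `2 × n` matrix, with rows `x` and `y`. -/
def genericMatrix (n : ℕ) : Matrix (Fin 2) (Fin n) (CoordRing n) := Matrix.of ![x, y]

/-- The `2`-minor `Δᵢⱼ = xᵢ yⱼ - xⱼ yᵢ` of the generic matrix on the columns `i`, `j`. -/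
def minor (i j : Fin n) : CoordRing n := ((genericMatrix n).submatrix id ![i, j]).det

/-- The defining polynomial of the determinantal arrangement of a graph on `n` vertices:
the product of the minors `Δᵢⱼ`, `i < j`, over the edges of the graph. -/
def arrangementPoly (G : SimpleGraph (Fin n)) [DecidableRel G.Adj] : CoordRing n :=
  ∏ p : Fin n × Fin n with p.1 < p.2 ∧ G.Adj p.1 p.2, minor p.1 p.2

/-- The module `Der(-log f)` of the vector fields `θ` with `θ(f) ∈ (f)`. -/
def logDer (f : CoordRing n) : Submodule (CoordRing n) (VectorField n) where
  carrier := {θ | θ f ∈ Ideal.span {f}}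
  add_mem' := fun ha hb => by
    simpa using Ideal.add_mem _ ha hb
  zero_mem' := by simp
  smul_mem' := fun c _ h => by
    simpa using Ideal.mul_mem_left _ c h

/-- The divisor of the nonzero polynomial `f` is free if `Der(-log f)` is a free module. -/
def IsFreeDivisor (f : CoordRing n) : Prop :=
  f ≠ 0 ∧ Module.Free (CoordRing n) (logDer f)

/-- A vector field all of whose coefficients are homogeneous polynomials of degree `d`. -/
def IsHomogeneousField (θ : VectorField n) (d : ℕ) : Prop :=
  ∀ v : Fin n ⊕ Fin n, (θ (MvPolynomial.X v)).IsHomogeneous d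

/-- `α = ∑ₖ xₖ ∂/∂yₖ`. -/
def α (n : ℕ) : VectorField n := ∑ k, x k • dy k

/-- `β = ∑ₖ yₖ ∂/∂xₖ`. -/
def β (n : ℕ) : VectorField n := ∑ k, y k • dx k

/-- `γ = ∑ₖ yₖ ∂/∂yₖ`. -/
def γ (n : ℕ) : VectorField n := ∑ k, y k • dy k

/-- The scaling `θₖ = xₖ ∂/∂xₖ + yₖ ∂/∂yₖ` of column `k`. -/
def θ (k : Fin n) : VectorField n := x k • dx k + y k • dy k

/-- The columns other than the first three and `k`. -/
def tailWithout (k : Fin n) : Finset (Fin n) := {j | 3 ≤ j.val ∧ j ≠ k}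

/-- The polynomial `a_{m,k}`: the sum, over the `m`-element sets `S` of columns other than the
first three and `k`, of the product of the `xⱼ`, `j ∈ S`, and of the `yⱼ`, `j ∉ S`, among these
columns. (In the sum over all orderings `j₁, …, j_{n-4}` of these columns of the monomials
`x_{j₁} ⋯ x_{jₘ} y_{jₘ₊₁} ⋯ y_{j_{n-4}}` each term occurs `m! (n-4-m)!` times.) -/
def a (m : ℕ) (k : Fin n) : CoordRing n :=
  ∑ S ∈ (tailWithout k).powersetCard m, (∏ j ∈ S, x j) * ∏ j ∈ tailWithout k \ S, y j

/-- `φₘ = ∑_{k ≥ 4} a_{m,k} Δ₂ₖ Δ₃ₖ (x₁ ∂/∂xₖ + y₁ ∂/∂yₖ)`, in the numbering of columns from `1`. -/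
def φ (hn : 3 ≤ n) (m : ℕ) : VectorField n :=
  ∑ k : Fin n with 3 ≤ k.val,
    (a m k * minor ⟨1, by omega⟩ k * minor ⟨2, by omega⟩ k) •
      (x (⟨0, by omega⟩ : Fin n) • dx k + y (⟨0, by omega⟩ : Fin n) • dy k)

/-- The `2n` vector fields `α, β, γ`, `θₖ` for all columns `k`, and `φ₀, …, φ_{n-4}`. -/
def basisField (hn : 3 ≤ n) : Fin 3 ⊕ Fin n ⊕ Fin (n - 3) → VectorField n :=
  Sum.elim ![α n, β n, γ n] (Sum.elim θ fun m => φ hn m.val)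

/-- The coefficient matrix of the fields `basisField hn`: the column of a field lists its
coefficients with respect to the `∂/∂xᵢ` and the `∂/∂yᵢ`. -/
def coeffMatrix (hn : 3 ≤ n) :
    Matrix (Fin n ⊕ Fin n) (Fin 3 ⊕ Fin n ⊕ Fin (n - 3)) (CoordRing n) :=
  Matrix.of fun v b => basisField hn b (MvPolynomial.X v)

end DetArr

end

noncomputable section

namespace DetArr

open MvPolynomial

variable {n : ℕ}

/-! ### Minors -/

/-! The proof is Saito's criterion. The minors are pairwise non-associate primes, so a field is
logarithmic for `f` iff it is so for each minor, and the coefficient determinant of any `2n`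
logarithmic fields is divisible by `f` (`arrangementPoly_top_dvd_det`). For the given fields this
determinant is homogeneous of degree `3 + n + (n - 3)(n + 1) = n(n - 1) = deg f`, hence a constant
times `f`. Once the constant is nonzero, Cramer's rule expands every logarithmic field in the given
ones (`exists_basis_logDer`).

Two points are specific to these fields. `φ_mem_logDer` holds because `a_{m,i}` and `a_{m,j}` are
the same linear form evaluated at column `j` and at column `i`. The determinant is nonzero because a
linear relation restricts to a binary quadratic form vanishing at the first three columns, which
kills the coefficients of `α`, `β`, `γ`; the `θ` terms follow, and the `φ` terms by a
Vandermonde-type inversion of the matrix `(a_{m,k})`. -/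

theorem minor_eq (i j : Fin n) : minor i j = x i * y j - x j * y i := by
  simp [minor, genericMatrix, Matrix.det_fin_two]

/-- The point of `ℂ²ⁿ` with `xₖ = 1` and `yₗ = 1` and all other coordinates zero. -/
def unitPoint (k l : Fin n) : Fin n ⊕ Fin n → ℂ :=
  Sum.elim (Pi.single k 1) (Pi.single l 1)

theorem eval_unitPoint_minor (k l i j : Fin n) :
    eval (unitPoint k l) (minor i j) =
      Pi.single (M := fun _ => ℂ) k 1 i * Pi.single (M := fun _ => ℂ) l 1 j -
        Pi.single (M := fun _ => ℂ) k 1 j * Pi.single (M := fun _ => ℂ) l 1 i := by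
  simp [minor_eq, x, y, unitPoint]

theorem minor_ne_zero {i j : Fin n} (h : i ≠ j) : minor i j ≠ 0 := fun h0 => by
  have := eval_unitPoint_minor i j i j
  simp [h0, h] at this

/-- At `unitPoint k l` the minor on `k, l` equals 1, while every other minor with increasing indices
vanishes. -/
theorem not_minor_dvd_minor {i j k l : Fin n} (hij : i < j) (hkl : k < l)
    (h : (i, j) ≠ (k, l)) : ¬ minor i j ∣ minor k l := by
  rintro ⟨q, hq⟩
  have e := congrArg (eval (unitPoint k l)) hq
  rw [map_mul, eval_unitPoint_minor, eval_unitPoint_minor] at e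
  have h1 : ¬ (i = k ∧ j = l) := fun h' => h (by rw [h'.1, h'.2])
  have h2 : ¬ (j = k ∧ i = l) := by rintro ⟨rfl, rfl⟩; exact absurd hij hkl.asymm
  have e1 : Pi.single (M := fun _ => ℂ) k 1 i * Pi.single (M := fun _ => ℂ) l 1 j = 0 := by
    by_cases hi : i = k
    · have : j ≠ l := fun hj => h1 ⟨hi, hj⟩
      simp [Pi.single_apply, this]
    · simp [Pi.single_apply, hi]
  have e2 : Pi.single (M := fun _ => ℂ) k 1 j * Pi.single (M := fun _ => ℂ) l 1 i = 0 := by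
    by_cases hi : j = k
    · have : i ≠ l := fun hj => h2 ⟨hi, hj⟩
      simp [Pi.single_apply, this]
    · simp [Pi.single_apply, hi]
  rw [e1, e2] at e
  simp [hkl.ne'] at e

theorem not_minor_dvd_y {i j : Fin n} (h : i ≠ j) : ¬ minor i j ∣ y j := by
  rintro ⟨q, hq⟩
  have e := congrArg (eval (unitPoint j j)) hq
  rw [map_mul, eval_unitPoint_minor] at e
  simp [h, y, unitPoint] at e

/-- The minor is linear in `x i`, and its leading coefficient `y j` is coprime to the constant term
`-(x j * y i)`. -/
theorem prime_minor {i j : Fin n} (h : i ≠ j) : Prime (minor i j) := by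
  rw [← UniqueFactorizationMonoid.irreducible_iff_prime]
  have e : minor i j = y j * X (Sum.inl i) + -(x j * y i) := by
    rw [minor_eq, x, x, y, y]; ring
  rw [e]
  refine irreducible_mul_X_add _ _ _ (X_ne_zero _) ?_ ?_ ?_
  · simp [y, vars_X]
  · rw [vars_neg]
    intro hm
    have := vars_mul _ _ hm
    simp [x, y, vars_X, h] at this
  · have hp : Prime (y j) := X_prime
    refine (hp.irreducible.isRelPrime_iff_not_dvd).2 ?_
    rw [dvd_neg, hp.dvd_mul]
    simp [x, y, X_dvd_X, h.symm]

theorem isHomogeneous_x (i : Fin n) : (x i).IsHomogeneous 1 := isHomogeneous_X _ _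

theorem isHomogeneous_y (i : Fin n) : (y i).IsHomogeneous 1 := isHomogeneous_X _ _

theorem isHomogeneous_minor (i j : Fin n) : (minor i j).IsHomogeneous 2 := by
  rw [minor_eq]
  exact ((isHomogeneous_x _).mul (isHomogeneous_y _)).sub
    ((isHomogeneous_x _).mul (isHomogeneous_y _))

theorem derivation_minor (D : VectorField n) (i j : Fin n) :
    D (minor i j) = x i * D (y j) + y j * D (x i) - (x j * D (y i) + y i * D (x j)) := by
  simp [minor_eq]

theorem derivation_sum_apply {ι : Type*} (s : Finset ι) (D : ι → VectorField n)
    (p : CoordRing n) : (∑ i ∈ s, D i) p = ∑ i ∈ s, D i p := by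
  classical
  induction s using Finset.induction_on with
  | empty => simp
  | insert i s hi ih => rw [Finset.sum_insert hi, Finset.sum_insert hi, Derivation.add_apply, ih]

theorem derivation_eq_sum (D : VectorField n) :
    D = ∑ v, D (X v) • (pderiv v : VectorField n) := by
  refine derivation_ext fun w => ?_
  rw [derivation_sum_apply]
  simp only [Derivation.smul_apply, pderiv_X, smul_eq_mul, Pi.single_apply, mul_ite, mul_one,
    mul_zero, Finset.sum_ite_eq, Finset.mem_univ, if_true]

/-! ### The defining polynomial of the complete graph -/

theorem arrangementPoly_top :
    arrangementPoly (⊤ : SimpleGraph (Fin n)) =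
      ∏ p : Fin n × Fin n with p.1 < p.2, minor p.1 p.2 := by
  rw [arrangementPoly]
  congr 1
  ext p
  simp only [SimpleGraph.top_adj, Finset.mem_filter, Finset.mem_univ, true_and]
  exact ⟨fun h => h.1, fun h => ⟨h, h.ne⟩⟩

theorem arrangementPoly_top_ne_zero : arrangementPoly (⊤ : SimpleGraph (Fin n)) ≠ 0 := by
  rw [arrangementPoly_top]
  exact Finset.prod_ne_zero_iff.2 fun p hp => minor_ne_zero (Finset.mem_filter.1 hp).2.ne

theorem arrangementPoly_top_dvd {g : CoordRing n}
    (h : ∀ i j : Fin n, i < j → minor i j ∣ g) :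
    arrangementPoly (⊤ : SimpleGraph (Fin n)) ∣ g := by
  rw [arrangementPoly_top]
  refine Finset.prod_dvd_of_isRelPrime ?_ fun p hp => h _ _ (Finset.mem_filter.1 hp).2
  intro p hp q hq hpq
  have hp' : p.1 < p.2 := by simpa using hp
  have hq' : q.1 < q.2 := by simpa using hq
  exact ((prime_minor hp'.ne).irreducible.isRelPrime_iff_not_dvd).2
    (not_minor_dvd_minor hp' hq' hpq)

theorem card_pairs_lt (n : ℕ) :
    2 * (Finset.univ.filter fun p : Fin n × Fin n => p.1 < p.2).card = n * (n - 1) := by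
  rw [← Finset.sum_range_id_mul_two, mul_comm]
  congr 1
  rw [Finset.card_filter, Fintype.sum_prod_type_right, ← Fin.sum_univ_eq_sum_range]
  refine Finset.sum_congr rfl fun j _ => ?_
  rw [← Finset.card_filter, ← Fin.card_Iio j]
  congr 1
  ext i
  simp

theorem isHomogeneous_arrangementPoly_top :
    (arrangementPoly (⊤ : SimpleGraph (Fin n))).IsHomogeneous (n * (n - 1)) := by
  rw [arrangementPoly_top, ← card_pairs_lt, mul_comm, ← smul_eq_mul, ← Finset.sum_const]
  exact IsHomogeneous.prod _ _ _ fun p _ => isHomogeneous_minor _ _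

/-! ### Logarithmic vector fields -/

theorem dvd_derivation_prod {ι : Type*} (s : Finset ι) (g : ι → CoordRing n)
    (D : VectorField n) (h : ∀ i ∈ s, g i ∣ D (g i)) : ∏ i ∈ s, g i ∣ D (∏ i ∈ s, g i) := by
  classical
  induction s using Finset.induction_on with
  | empty => exact (Finset.prod_empty (f := g)).symm ▸ one_dvd _
  | insert i s hi ih =>
    rw [Finset.prod_insert hi, Derivation.leibniz, smul_eq_mul, smul_eq_mul]
    have hs := ih fun j hj => h j (Finset.mem_insert_of_mem hj)
    refine dvd_add (mul_dvd_mul_left _ hs) ?_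
    rw [mul_comm]
    exact mul_dvd_mul_left _ (h i (Finset.mem_insert_self _ _))

theorem mem_logDer_arrangementPoly_top {D : VectorField n} :
    D ∈ logDer (arrangementPoly (⊤ : SimpleGraph (Fin n))) ↔
      ∀ i j : Fin n, i < j → minor i j ∣ D (minor i j) := by
  change D _ ∈ Ideal.span {_} ↔ _
  rw [Ideal.mem_span_singleton, arrangementPoly_top]
  constructor
  · intro h i j hij
    have hm : (i, j) ∈ Finset.univ.filter fun p : Fin n × Fin n => p.1 < p.2 := by simpa
    rw [← Finset.mul_prod_erase _ _ hm, Derivation.leibniz, smul_eq_mul, smul_eq_mul] at h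
    -- Modulo the minor, Leibniz leaves the product of the other minors times `D (minor i j)`.
    have h' := (dvd_add_right (dvd_mul_right _ _)).1 (dvd_of_mul_right_dvd h)
    refine ((prime_minor hij.ne).dvd_or_dvd h').resolve_left fun hd => ?_
    obtain ⟨q, hq, hdq⟩ := ((prime_minor hij.ne).dvd_finsetProd_iff _).1 hd
    rw [Finset.mem_erase, Finset.mem_filter] at hq
    exact not_minor_dvd_minor hij hq.2.2 hq.1.symm hdq
  · intro h
    exact dvd_derivation_prod _ _ _ fun p hp => h _ _ (Finset.mem_filter.1 hp).2

/-- The gradient row of a minor times `M` has all entries divisible by that minor. Multiplying by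
the adjugate gives the gradient times `det M`; its `x i` entry is `y j * det M`, and the prime minor
does not divide `y j`. -/
theorem arrangementPoly_top_dvd_det (D : Fin n ⊕ Fin n → VectorField n)
    (hD : ∀ b, D b ∈ logDer (arrangementPoly (⊤ : SimpleGraph (Fin n)))) :
    arrangementPoly (⊤ : SimpleGraph (Fin n)) ∣
      (Matrix.of fun v b => D b (X v)).det := by
  refine arrangementPoly_top_dvd fun i j hij => ?_
  set M : Matrix (Fin n ⊕ Fin n) (Fin n ⊕ Fin n) (CoordRing n) :=
    Matrix.of fun v b => D b (X v)
  set w : Fin n ⊕ Fin n → CoordRing n := fun v => pderiv v (minor i j)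
  have hw : Matrix.vecMul w M = fun b => D b (minor i j) := by
    funext b
    conv_rhs => rw [derivation_eq_sum (D b), derivation_sum_apply]
    rw [Matrix.vecMul, dotProduct]
    exact Finset.sum_congr rfl fun v _ => mul_comm (w v) (M v b)
  have key : Matrix.vecMul (Matrix.vecMul w M) M.adjugate (Sum.inl i) = y j * M.det := by
    have hwi : w (Sum.inl i) = y j := by
      simp [w, derivation_minor, x, y, pderiv_X, Pi.single_apply, hij.ne']
    rw [Matrix.vecMul_vecMul, Matrix.mul_adjugate, Matrix.vecMul_smul, Matrix.vecMul_one,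
      Pi.smul_apply, hwi, smul_eq_mul, mul_comm]
  have hdvd : minor i j ∣ y j * M.det := by
    rw [← key, hw, Matrix.vecMul, dotProduct]
    exact Finset.dvd_sum fun b _ =>
      Dvd.dvd.mul_right (mem_logDer_arrangementPoly_top.1 (hD b) i j hij) _
  exact ((prime_minor hij.ne).dvd_or_dvd hdvd).resolve_left (not_minor_dvd_y hij.ne)

theorem exists_basis_submodule {R V ι : Type*} [Semiring R] [AddCommMonoid V] [Module R V]
    [Fintype ι] {N : Submodule R V} {v : ι → V} (hv : ∀ i, v i ∈ N)
    (hinj : ∀ g h : ι → R, ∑ i, g i • v i = ∑ i, h i • v i → g = h)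
    (hspan : ∀ w ∈ N, ∃ g : ι → R, w = ∑ i, g i • v i) :
    ∃ b : Module.Basis ι R N, ∀ i, (b i : V) = v i := by
  have hli : LinearIndependent R (fun i => (⟨v i, hv i⟩ : N)) := by
    rw [Fintype.linearIndependent_iffₛ]
    intro g h hgh
    have : g = h := hinj g h (by simpa using congrArg (fun w : N => (w : V)) hgh)
    simp [this]
  refine ⟨Module.Basis.mk hli ?_, fun i => by rw [Module.Basis.mk_apply]⟩
  rintro ⟨w, hw⟩ -
  obtain ⟨g, rfl⟩ := hspan w hw
  have : (⟨∑ i, g i • v i, hw⟩ : N) = ∑ i, g i • (⟨v i, hv i⟩ : N) := Subtype.ext (by simp)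
  rw [this]
  exact Submodule.sum_mem _ fun i _ => Submodule.smul_mem _ _
    (Submodule.subset_span (Set.mem_range_self i))

/-- Saito's criterion, for an arrangement of all minors: logarithmic vector fields whose
coefficient determinant is a nonzero constant multiple of `f` form a basis of `Der(-log f)`. -/
theorem exists_basis_logDer {ι : Type*} [Fintype ι] (e : (Fin n ⊕ Fin n) ≃ ι)
    (D : ι → VectorField n)
    (hD : ∀ b, D b ∈ logDer (arrangementPoly (⊤ : SimpleGraph (Fin n)))) {c : ℂ} (hc : c ≠ 0)
    (hdet : ((Matrix.of fun v b => D b (X v)).submatrix id e).det =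
      C c * arrangementPoly (⊤ : SimpleGraph (Fin n))) :
    ∃ b : Module.Basis ι (CoordRing n) (logDer (arrangementPoly (⊤ : SimpleGraph (Fin n)))),
      ∀ i, (b i : VectorField n) = D i := by
  set f := arrangementPoly (⊤ : SimpleGraph (Fin n))
  have hf : f ≠ 0 := arrangementPoly_top_ne_zero
  set M : Matrix (Fin n ⊕ Fin n) (Fin n ⊕ Fin n) (CoordRing n) :=
    (Matrix.of fun v b => D b (X v)).submatrix id e
  have hC : (C c : CoordRing n) ≠ 0 := by simpa using hc
  have hM : M.det ≠ 0 := by rw [hdet]; exact mul_ne_zero hC hf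
  refine exists_basis_submodule hD (fun g h hgh => ?_) fun δ hδ => ?_
  · have hv : M.mulVec ((g - h) ∘ e) = 0 := by
      funext v
      have := congrArg (fun δ : VectorField n => δ (X v)) hgh
      simp only [derivation_sum_apply, Derivation.smul_apply, smul_eq_mul] at this
      rw [← sub_eq_zero, ← Finset.sum_sub_distrib, ← e.sum_comp] at this
      rw [Matrix.mulVec, dotProduct]
      refine Eq.trans (Finset.sum_congr rfl fun b _ => ?_) this
      change D (e b) (X v) * (g (e b) - h (e b)) = _
      ring
    have h0 := Matrix.eq_zero_of_mulVec_eq_zero hM hv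
    funext i
    have := congrFun h0 (e.symm i)
    simpa [sub_eq_zero] using this
  -- A Cramer numerator is again the coefficient determinant of logarithmic fields, with `δ` in
  -- place of one of them.
  have hq : ∀ b, f ∣ M.cramer (fun v => δ (X v)) b := by
    intro b
    have := arrangementPoly_top_dvd_det (Function.update (D ∘ e) b δ) (fun b' => by
      by_cases h : b' = b
      · subst h; simpa using hδ
      · simpa [h] using hD _)
    rw [Matrix.cramer_apply]
    convert this using 2
    ext1 v b'
    by_cases h : b' = b
    · subst h; simp
    · simp [h, M]
  choose q hq using hq
  have hsol : ∀ v, C c * δ (X v) = ∑ b, D (e b) (X v) * q b := by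
    intro v
    have := congrFun (Matrix.mulVec_cramer M fun v => δ (X v)) v
    rw [Pi.smul_apply, smul_eq_mul, hdet] at this
    refine mul_left_cancel₀ hf ?_
    calc f * (C c * δ (X v)) = C c * f * δ (X v) := by ring
      _ = ∑ b, D (e b) (X v) * M.cramer (fun v => δ (X v)) b := this.symm
      _ = _ := by
        rw [Finset.mul_sum]
        exact Finset.sum_congr rfl fun b _ => by rw [hq]; ring
  refine ⟨fun i => C c⁻¹ * q (e.symm i), derivation_ext fun v => ?_⟩
  simp only [derivation_sum_apply, Derivation.smul_apply, smul_eq_mul]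
  rw [← e.sum_comp]
  refine mul_left_cancel₀ hC ?_
  rw [hsol, Finset.mul_sum]
  refine Finset.sum_congr rfl fun b _ => ?_
  have : (C c : CoordRing n) * C c⁻¹ = 1 := by rw [← C_mul, mul_inv_cancel₀ hc, C_1]
  rw [Equiv.symm_apply_apply]
  linear_combination (-(q b * D (e b) (X v))) * this

/-! ### Values of the fields on coordinates -/

@[simp] theorem dx_x (i j : Fin n) : dx i (x j) = if j = i then 1 else 0 := by
  simp [dx, x, pderiv_X, Pi.single_apply]

@[simp] theorem dx_y (i j : Fin n) : dx i (y j) = 0 := by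
  simp [dx, y, pderiv_X]

@[simp] theorem dy_x (i j : Fin n) : dy i (x j) = 0 := by
  simp [dy, x, pderiv_X]

@[simp] theorem dy_y (i j : Fin n) : dy i (y j) = if j = i then 1 else 0 := by
  simp [dy, y, pderiv_X, Pi.single_apply]

@[simp] theorem α_x (k : Fin n) : α n (x k) = 0 := by simp [α, derivation_sum_apply]

@[simp] theorem α_y (k : Fin n) : α n (y k) = x k := by simp [α, derivation_sum_apply]

@[simp] theorem β_x (k : Fin n) : β n (x k) = y k := by simp [β, derivation_sum_apply]

@[simp] theorem β_y (k : Fin n) : β n (y k) = 0 := by simp [β, derivation_sum_apply]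

@[simp] theorem γ_x (k : Fin n) : γ n (x k) = 0 := by simp [γ, derivation_sum_apply]

@[simp] theorem γ_y (k : Fin n) : γ n (y k) = y k := by simp [γ, derivation_sum_apply]

@[simp] theorem θ_x (k l : Fin n) : θ k (x l) = if l = k then x l else 0 := by
  by_cases h : l = k <;> simp [θ, h]

@[simp] theorem θ_y (k l : Fin n) : θ k (y l) = if l = k then y l else 0 := by
  by_cases h : l = k <;> simp [θ, h]

/-- The coefficient of `x₀ ∂/∂xₖ + y₀ ∂/∂yₖ` in `φₘ`. -/
def φCoeff (hn : 3 ≤ n) (m : ℕ) (k : Fin n) : CoordRing n :=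
  if 3 ≤ k.val then a m k * minor ⟨1, by omega⟩ k * minor ⟨2, by omega⟩ k else 0

theorem φ_x (hn : 3 ≤ n) (m : ℕ) (k : Fin n) :
    φ hn m (x k) = φCoeff hn m k * x ⟨0, by omega⟩ := by
  simp [φ, φCoeff, derivation_sum_apply, Finset.sum_ite_eq, ite_mul]

theorem φ_y (hn : 3 ≤ n) (m : ℕ) (k : Fin n) :
    φ hn m (y k) = φCoeff hn m k * y ⟨0, by omega⟩ := by
  simp [φ, φCoeff, derivation_sum_apply, Finset.sum_ite_eq, ite_mul]

/-! ### The polynomials `a_{m,k}` -/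

/-- The coefficient of `tᵐ` in the product of the `yⱼ + t xⱼ`, `j ∈ T`. -/
def mixedEsymm (T : Finset (Fin n)) (m : ℕ) : CoordRing n :=
  ∑ S ∈ T.powersetCard m, (∏ j ∈ S, x j) * ∏ j ∈ T \ S, y j

theorem isHomogeneous_mixedEsymm (T : Finset (Fin n)) (m : ℕ) :
    (mixedEsymm T m).IsHomogeneous T.card := by
  refine IsHomogeneous.sum _ _ _ fun S hS => ?_
  have hST := (Finset.mem_powersetCard.1 hS).1
  have h1 := IsHomogeneous.prod S x (fun _ => 1) fun j _ => isHomogeneous_x j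
  have h2 := IsHomogeneous.prod (T \ S) y (fun _ => 1) fun j _ => isHomogeneous_y j
  have := h1.mul h2
  rwa [Finset.sum_const, Finset.sum_const, smul_eq_mul, smul_eq_mul, mul_one, mul_one, add_comm,
    Finset.card_sdiff_add_card_eq_card hST] at this

/-- The product of the `y + t x` gains one factor `y j + t x j`. The point is that `p` and `q` do
not depend on `j`. -/
theorem exists_mixedEsymm_insert (T : Finset (Fin n)) (m : ℕ) :
    ∃ p q, ∀ j ∉ T, mixedEsymm (insert j T) m = x j * p + y j * q := by
  have hy : ∀ j ∉ T, ∀ S ⊆ T, (∏ i ∈ S, x i) * ∏ i ∈ insert j T \ S, y i =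
      y j * ((∏ i ∈ S, x i) * ∏ i ∈ T \ S, y i) := by
    intro j hj S hS
    rw [Finset.insert_sdiff_of_notMem _ (fun h => hj (hS h)), Finset.prod_insert (by simp [hj])]
    ring
  cases m with
  | zero =>
    refine ⟨0, mixedEsymm T 0, fun j hj => ?_⟩
    have := hy j hj ∅ (Finset.empty_subset _)
    simpa [mixedEsymm] using this
  | succ m =>
    refine ⟨mixedEsymm T m, mixedEsymm T (m + 1), fun j hj => ?_⟩
    rw [mixedEsymm, Finset.powersetCard_succ_insert hj, Finset.sum_union, add_comm]
    · congr 1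
      · rw [Finset.sum_image, mixedEsymm, Finset.mul_sum]
        · refine Finset.sum_congr rfl fun S hS => ?_
          have hjS : j ∉ S := fun h => hj ((Finset.mem_powersetCard.1 hS).1 h)
          rw [Finset.prod_insert hjS, Finset.insert_sdiff_insert,
            Finset.sdiff_insert_of_notMem hj, mul_assoc]
        · intro S hS S' hS' h
          have hjS : j ∉ S := fun h => hj ((Finset.mem_powersetCard.1 hS).1 h)
          have hjS' : j ∉ S' := fun h => hj ((Finset.mem_powersetCard.1 hS').1 h)
          rw [← Finset.erase_insert hjS, ← Finset.erase_insert hjS', h]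
      · rw [mixedEsymm, Finset.mul_sum]
        exact Finset.sum_congr rfl fun S hS => hy j hj S (Finset.mem_powersetCard.1 hS).1
    · rw [Finset.disjoint_left]
      intro S hS hS'
      obtain ⟨S', -, rfl⟩ := Finset.mem_image.1 hS'
      exact hj ((Finset.mem_powersetCard.1 hS).1 (Finset.mem_insert_self _ _))

theorem sum_mixedEsymm_mul (T : Finset (Fin n)) (s t : CoordRing n) :
    ∑ m ∈ Finset.range (T.card + 1), mixedEsymm T m * (t ^ m * s ^ (T.card - m)) =
      ∏ j ∈ T, (x j * t + y j * s) := by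
  rw [Finset.prod_add, Finset.sum_powerset]
  refine Finset.sum_congr rfl fun m _ => ?_
  rw [mixedEsymm, Finset.sum_mul]
  refine Finset.sum_congr rfl fun S hS => ?_
  obtain ⟨hST, hm⟩ := Finset.mem_powersetCard.1 hS
  rw [Finset.prod_mul_distrib, Finset.prod_mul_distrib, Finset.prod_const, Finset.prod_const,
    Finset.card_sdiff_of_subset hST, hm]
  ring

theorem card_tailWithout {k : Fin n} (hk : 3 ≤ k.val) : (tailWithout k).card + 1 = n - 3 := by
  have h : insert k (tailWithout k) = Finset.univ.image
      (fun m : Fin (n - 3) => (⟨m.val + 3, by omega⟩ : Fin n)) := by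
    ext j
    simp only [tailWithout, Finset.mem_insert, Finset.mem_filter, Finset.mem_univ, true_and,
      Finset.mem_image]
    constructor
    · intro h
      have hj : 3 ≤ j.val := by
        rcases h with rfl | h
        · exact hk
        · exact h.1
      exact ⟨⟨j.val - 3, by omega⟩, Fin.ext (by simp; omega)⟩
    · rintro ⟨m, rfl⟩
      simp only [le_add_iff_nonneg_left, zero_le, ne_eq, true_and]
      exact em _
  have hc := congrArg Finset.card h
  rw [Finset.card_insert_of_notMem (by simp [tailWithout]), Finset.card_image_of_injective _
    (fun m m' h => Fin.ext (by simpa using h)), Finset.card_univ, Fintype.card_fin] at hc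
  exact hc

theorem insert_tailWithout_inter {i j : Fin n} (hj : 3 ≤ j.val) (hij : i ≠ j) :
    tailWithout i = insert j (tailWithout i ∩ tailWithout j) := by
  ext l
  simp only [tailWithout, Finset.mem_insert, Finset.mem_inter, Finset.mem_filter,
    Finset.mem_univ, true_and]
  by_cases h : l = j
  · subst h; simp [hj, hij.symm]
  · simp [h]
    tauto

/-! ### The fields are logarithmic -/

theorem φCoeff_of_lt (hn : 3 ≤ n) (m : ℕ) {k : Fin n} (hk : k.val < 3) :
    φCoeff hn m k = 0 := if_neg (by omega)

theorem φCoeff_of_le (hn : 3 ≤ n) (m : ℕ) {k : Fin n} (hk : 3 ≤ k.val) :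
    φCoeff hn m k = a m k * minor ⟨1, by omega⟩ k * minor ⟨2, by omega⟩ k := if_pos hk

theorem φ_minor (hn : 3 ≤ n) (m : ℕ) (i j : Fin n) :
    φ hn m (minor i j) = φCoeff hn m i * minor ⟨0, by omega⟩ j -
      φCoeff hn m j * minor ⟨0, by omega⟩ i := by
  rw [derivation_minor, φ_x, φ_x, φ_y, φ_y, minor_eq, minor_eq]
  ring

theorem φ_mem_logDer (hn : 3 ≤ n) (m : ℕ) :
    φ hn m ∈ logDer (arrangementPoly (⊤ : SimpleGraph (Fin n))) := by
  rw [mem_logDer_arrangementPoly_top]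
  intro i j hij
  rw [φ_minor]
  rw [Fin.lt_def] at hij
  rcases lt_or_ge j.val 3 with hj | hj
  · rw [φCoeff_of_lt hn m hj, φCoeff_of_lt hn m (hij.trans hj)]
    simp
  rcases lt_or_ge i.val 3 with hi | hi
  · rw [φCoeff_of_lt hn m hi, φCoeff_of_le hn m hj, zero_mul, zero_sub, dvd_neg]
    have : i = ⟨0, by omega⟩ ∨ i = ⟨1, by omega⟩ ∨ i = ⟨2, by omega⟩ := by
      simp only [Fin.ext_iff]; omega
    -- Against column 0 the minor `Δ₀ᵢ` vanishes; for columns 1 and 2 the required minor is a factor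
    -- built into `φCoeff`.
    rcases this with h | h | h
    · simp [h, minor_eq]
    · rw [← h]
      exact (Dvd.intro_left _ rfl).mul_right _ |>.mul_right _
    · rw [← h]
      exact (Dvd.intro_left _ rfl).mul_right _
  · have hne : i ≠ j := fun h => by subst h; exact lt_irrefl _ hij
    rw [φCoeff_of_le hn m hi, φCoeff_of_le hn m hj]
    obtain ⟨p, q, hpq⟩ := exists_mixedEsymm_insert (tailWithout i ∩ tailWithout j) m
    have hai : a m i = x j * p + y j * q := by
      rw [← hpq j (by simp [tailWithout]), ← insert_tailWithout_inter hj hne]; rfl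
    have haj : a m j = x i * p + y i * q := by
      rw [← hpq i (by simp [tailWithout]), Finset.inter_comm,
        ← insert_tailWithout_inter hi hne.symm]; rfl
    rw [hai, haj]
    generalize (⟨0, by omega⟩ : Fin n) = u
    generalize (⟨1, by omega⟩ : Fin n) = v
    generalize (⟨2, by omega⟩ : Fin n) = w
    -- The cofactor comes from `x_j Δ_{vi} = x_i Δ_{vj} - x_v Δ_{ij}`, its analogue in `y`, and the
    -- Plücker relation `Δ_{wi} Δ_{uj} - Δ_{wj} Δ_{ui} = Δ_{wu} Δ_{ij}`.
    refine Dvd.intro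
      (p * (-(x v) * minor w i * minor u j + x i * minor v j * minor w u) +
        q * (-(y v) * minor w i * minor u j + y i * minor v j * minor w u)) ?_
    simp only [minor_eq]
    ring

theorem basisField_mem_logDer (hn : 3 ≤ n) (b : Fin 3 ⊕ Fin n ⊕ Fin (n - 3)) :
    basisField hn b ∈ logDer (arrangementPoly (⊤ : SimpleGraph (Fin n))) := by
  rcases b with b | k | m
  · rw [mem_logDer_arrangementPoly_top]
    intro i j _
    rw [derivation_minor]
    fin_cases b
    · simp [basisField, mul_comm]
    · simp [basisField, mul_comm]
    · exact Dvd.intro 1 (by simp [basisField, minor_eq])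
  · rw [mem_logDer_arrangementPoly_top]
    intro i j _
    rw [derivation_minor]
    refine Dvd.intro ((if i = k then 1 else 0) + (if j = k then 1 else 0)) ?_
    simp only [basisField, Sum.elim_inr, Sum.elim_inl, θ_x, θ_y, minor_eq]
    split_ifs <;> ring
  · exact φ_mem_logDer hn m

/-! ### Degrees -/

theorem isHomogeneousField_iff {D : VectorField n} {d : ℕ} :
    IsHomogeneousField D d ↔
      ∀ k, (D (x k)).IsHomogeneous d ∧ (D (y k)).IsHomogeneous d :=
  ⟨fun h k => ⟨h (Sum.inl k), h (Sum.inr k)⟩, fun h v => by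
    rcases v with k | k
    · exact (h k).1
    · exact (h k).2⟩

theorem isHomogeneousField_α : IsHomogeneousField (α n) 1 :=
  isHomogeneousField_iff.2 fun k => by
    simpa [isHomogeneous_zero] using isHomogeneous_x k

theorem isHomogeneousField_β : IsHomogeneousField (β n) 1 :=
  isHomogeneousField_iff.2 fun k => by
    simpa [isHomogeneous_zero] using isHomogeneous_y k

theorem isHomogeneousField_γ : IsHomogeneousField (γ n) 1 :=
  isHomogeneousField_iff.2 fun k => by
    simpa [isHomogeneous_zero] using isHomogeneous_y k

theorem isHomogeneousField_θ (k : Fin n) : IsHomogeneousField (θ k) 1 :=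
  isHomogeneousField_iff.2 fun l => by
    by_cases h : l = k
    · simpa [h] using ⟨isHomogeneous_x k, isHomogeneous_y k⟩
    · simp [h, isHomogeneous_zero]

theorem isHomogeneous_φCoeff (hn : 3 ≤ n) (m : ℕ) (k : Fin n) :
    (φCoeff hn m k).IsHomogeneous n := by
  rcases lt_or_ge k.val 3 with hk | hk
  · rw [φCoeff_of_lt hn m hk]
    exact isHomogeneous_zero _ _ _
  · rw [φCoeff_of_le hn m hk]
    have h := ((isHomogeneous_mixedEsymm (tailWithout k) m).mul
      (isHomogeneous_minor ⟨1, by omega⟩ k)).mul (isHomogeneous_minor ⟨2, by omega⟩ k)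
    have hc := card_tailWithout hk
    rwa [show (tailWithout k).card + 2 + 2 = n by omega] at h

theorem isHomogeneousField_φ (hn : 3 ≤ n) (m : ℕ) : IsHomogeneousField (φ hn m) (n + 1) :=
  isHomogeneousField_iff.2 fun k => by
    rw [φ_x, φ_y]
    exact ⟨(isHomogeneous_φCoeff hn m k).mul (isHomogeneous_x _),
      (isHomogeneous_φCoeff hn m k).mul (isHomogeneous_y _)⟩

/-- The degrees of the fields `basisField`. -/
def fieldDegree (n : ℕ) : Fin 3 ⊕ Fin n ⊕ Fin (n - 3) → ℕ :=
  Sum.elim (fun _ => 1) (Sum.elim (fun _ => 1) fun _ => n + 1)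

theorem isHomogeneousField_basisField (hn : 3 ≤ n) (b : Fin 3 ⊕ Fin n ⊕ Fin (n - 3)) :
    IsHomogeneousField (basisField hn b) (fieldDegree n b) := by
  rcases b with b | k | m
  · fin_cases b
    · exact isHomogeneousField_α
    · exact isHomogeneousField_β
    · exact isHomogeneousField_γ
  · exact isHomogeneousField_θ k
  · exact isHomogeneousField_φ hn m

theorem sum_fieldDegree (hn : 3 ≤ n) : ∑ b, fieldDegree n b = n * (n - 1) := by
  obtain ⟨r, rfl⟩ := Nat.exists_eq_add_of_le' hn
  simp [fieldDegree, Fintype.sum_sum_type]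
  ring

theorem isHomogeneous_det_coeffMatrix (hn : 3 ≤ n)
    (e : (Fin n ⊕ Fin n) ≃ (Fin 3 ⊕ Fin n ⊕ Fin (n - 3))) :
    ((coeffMatrix hn).submatrix id e).det.IsHomogeneous (n * (n - 1)) := by
  rw [Matrix.det_apply, ← sum_fieldDegree hn, ← e.sum_comp]
  refine IsHomogeneous.sum _ _ _ fun σ _ => ?_
  have h := IsHomogeneous.prod Finset.univ
    (fun i => (coeffMatrix hn).submatrix id e (σ i) i) (fun i => fieldDegree n (e i))
    fun i _ => isHomogeneousField_basisField hn (e i) (σ i)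
  rcases Int.units_eq_one_or (Equiv.Perm.sign σ) with hs | hs
  · simpa [hs] using h
  · simpa [hs] using h.neg

/-! ### Nonvanishing of the determinant -/

/-- Evaluating the generating product over `tailWithout j` at column `k` gives `∏ Δ_{kl}`, which
contains `Δ_{kk} = 0` unless `j = k`. So `A * W` is diagonal with nonzero entries. -/
theorem eq_zero_of_sum_mul_a_eq_zero (hn : 3 ≤ n) {d : Fin (n - 3) → CoordRing n}
    (h : ∀ k : Fin n, 3 ≤ k.val → ∑ m, d m * a m.val k = 0) : d = 0 := by
  let κ : Fin (n - 3) → Fin n := fun m => ⟨m.val + 3, by omega⟩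
  have hκ : Function.Injective κ := fun m m' h => Fin.ext (by simpa [κ] using h)
  have hκ3 : ∀ m, 3 ≤ (κ m).val := fun m => Nat.le_add_left _ _
  let A : Matrix (Fin (n - 3)) (Fin (n - 3)) (CoordRing n) := Matrix.of fun k m => a m.val (κ k)
  let W : Matrix (Fin (n - 3)) (Fin (n - 3)) (CoordRing n) :=
    Matrix.of fun m k => (-y (κ k)) ^ m.val * x (κ k) ^ (n - 4 - m.val)
  have hAW : A * W = Matrix.diagonal fun k => ∏ l ∈ tailWithout (κ k), minor (κ k) l := by
    ext1 j k
    have hc := card_tailWithout (hκ3 j)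
    have hs := sum_mixedEsymm_mul (tailWithout (κ j)) (x (κ k)) (-y (κ k))
    rw [hc, ← Fin.sum_univ_eq_sum_range (fun m => mixedEsymm (tailWithout (κ j)) m *
      ((-y (κ k)) ^ m * x (κ k) ^ ((tailWithout (κ j)).card - m))),
      show (tailWithout (κ j)).card = n - 4 by omega] at hs
    have hprod : ∏ l ∈ tailWithout (κ j), (x l * -y (κ k) + y l * x (κ k)) =
        ∏ l ∈ tailWithout (κ j), minor (κ k) l :=
      Finset.prod_congr rfl fun l _ => by rw [minor_eq]; ring
    rw [Matrix.mul_apply]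
    refine (hs.trans hprod).trans ?_
    by_cases hjk : j = k
    · subst hjk; simp
    · rw [Matrix.diagonal_apply_ne _ hjk]
      refine Finset.prod_eq_zero (i := κ k) ?_ (by rw [minor_eq]; ring)
      simpa [tailWithout, hκ3 k] using hκ.ne (Ne.symm hjk)
  have hdet : A.det ≠ 0 := by
    intro h0
    have := congrArg Matrix.det hAW
    rw [Matrix.det_mul, h0, zero_mul, Matrix.det_diagonal] at this
    refine Finset.prod_ne_zero_iff.2 (fun k _ => ?_) this.symm
    refine Finset.prod_ne_zero_iff.2 fun l hl => minor_ne_zero ?_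
    exact (Finset.mem_filter.1 hl).2.2.symm
  refine Matrix.eq_zero_of_mulVec_eq_zero hdet ?_
  funext k
  have := h (κ k) (hκ3 k)
  simpa [Matrix.mulVec, dotProduct, A, mul_comm] using this

/-- A binary quadratic form that vanishes at three generic points is zero. -/
theorem quadraticForm_eq_zero {u v w : Fin n} (huv : u ≠ v) (huw : u ≠ w) (hvw : v ≠ w)
    {A B C : CoordRing n}
    (h : ∀ k, k = u ∨ k = v ∨ k = w → A * x k ^ 2 + B * (x k * y k) + C * y k ^ 2 = 0) :
    A = 0 ∧ B = 0 ∧ C = 0 := by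
  have hu := h u (by simp)
  have hv := h v (by simp)
  have hw := h w (by simp)
  have hne : minor u v * minor u w * minor v w ≠ 0 :=
    mul_ne_zero (mul_ne_zero (minor_ne_zero huv) (minor_ne_zero huw)) (minor_ne_zero hvw)
  refine ⟨(mul_eq_zero_iff_right hne).1 ?_, (mul_eq_zero_iff_right hne).1 ?_,
    (mul_eq_zero_iff_right hne).1 ?_⟩ <;> simp only [minor_eq]
  -- The multipliers are cofactors of the matrix with rows `(x², xy, y²)`, whose determinant is the
  -- product of the three minors.
  · linear_combination (x v * y v * y w ^ 2 - y v ^ 2 * x w * y w) * hu -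
      (x u * y u * y w ^ 2 - y u ^ 2 * x w * y w) * hv +
      (x u * y u * y v ^ 2 - y u ^ 2 * x v * y v) * hw
  · linear_combination -(x v ^ 2 * y w ^ 2 - y v ^ 2 * x w ^ 2) * hu +
      (x u ^ 2 * y w ^ 2 - y u ^ 2 * x w ^ 2) * hv -
      (x u ^ 2 * y v ^ 2 - y u ^ 2 * x v ^ 2) * hw
  · linear_combination (x v ^ 2 * x w * y w - x v * y v * x w ^ 2) * hu -
      (x u ^ 2 * x w * y w - x u * y u * x w ^ 2) * hv +
      (x u ^ 2 * x v * y v - x u * y u * x v ^ 2) * hw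

theorem eq_zero_of_sum_mul_basisField_eq_zero (hn : 3 ≤ n)
    {c : Fin 3 ⊕ Fin n ⊕ Fin (n - 3) → CoordRing n}
    (h : ∀ v, ∑ b, c b * basisField hn b (X v) = 0) : c = 0 := by
  set A := c (Sum.inl 0)
  set B := c (Sum.inl 1)
  set G := c (Sum.inl 2)
  set t : Fin n → CoordRing n := fun k => c (Sum.inr (Sum.inl k))
  set d : Fin (n - 3) → CoordRing n := fun m => c (Sum.inr (Sum.inr m))
  set s : Fin n → CoordRing n := fun k => ∑ m, d m * φCoeff hn m.val k
  have hx : ∀ k, B * y k + (t k * x k + s k * x ⟨0, by omega⟩) = 0 := by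
    intro k
    have := h (Sum.inl k)
    rw [show (X (Sum.inl k) : CoordRing n) = x k from rfl] at this
    simpa [Fintype.sum_sum_type, Fin.sum_univ_three, basisField, φ_x, s, Finset.sum_mul,
      mul_assoc] using this
  have hy : ∀ k, A * x k + G * y k + (t k * y k + s k * y ⟨0, by omega⟩) = 0 := by
    intro k
    have := h (Sum.inr k)
    rw [show (X (Sum.inr k) : CoordRing n) = y k from rfl] at this
    simpa [Fintype.sum_sum_type, Fin.sum_univ_three, basisField, φ_y, s, Finset.sum_mul,
      mul_assoc] using this
  have hs3 : ∀ k : Fin n, k.val < 3 → s k = 0 := fun k hk => by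
    simp [s, φCoeff_of_lt hn _ hk]
  obtain ⟨hA0, hG0, hB0⟩ : A = 0 ∧ G = 0 ∧ -B = 0 := by
    refine quadraticForm_eq_zero (u := ⟨0, by omega⟩) (v := ⟨1, by omega⟩) (w := ⟨2, by omega⟩)
      (by simp) (by simp) (by simp) fun k hk => ?_
    have hk3 : k.val < 3 := by rcases hk with rfl | rfl | rfl <;> simp
    have h1 := hx k
    have h2 := hy k
    rw [hs3 k hk3] at h1 h2
    -- This combination eliminates `t k`.
    linear_combination x k * h2 - y k * h1
  rw [neg_eq_zero] at hB0
  have ht0 : ∀ k, t k = 0 := by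
    intro k
    have h1 := hx k
    have h2 := hy k
    rw [hB0] at h1
    rw [hA0, hG0] at h2
    rcases lt_or_ge k.val 3 with hk | hk
    · rw [hs3 k hk] at h1
      have : t k * x k = 0 := by linear_combination h1
      exact (mul_eq_zero.1 this).resolve_right (X_ne_zero _)
    · have : t k * minor k ⟨0, by omega⟩ = 0 := by
        rw [minor_eq]
        -- Pairing with column 0 eliminates `s k`, since the `φ` terms point along that column.
        linear_combination y ⟨0, by omega⟩ * h1 - x ⟨0, by omega⟩ * h2
      refine (mul_eq_zero.1 this).resolve_right (minor_ne_zero fun h => ?_)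
      rw [h] at hk
      simp at hk
  have hd0 : d = 0 := by
    refine eq_zero_of_sum_mul_a_eq_zero hn fun k hk => ?_
    have h1 := hx k
    rw [hB0, ht0, zero_mul, zero_mul, zero_add, zero_add] at h1
    have hsk : s k = 0 := (mul_eq_zero.1 h1).resolve_right (X_ne_zero _)
    have hfac : (∑ m, d m * a m.val k) *
        (minor ⟨1, by omega⟩ k * minor ⟨2, by omega⟩ k) = 0 := by
      rw [← hsk, Finset.sum_mul]
      exact Finset.sum_congr rfl fun m _ => by rw [φCoeff_of_le hn _ hk]; ring
    refine (mul_eq_zero.1 hfac).resolve_right (mul_ne_zero (minor_ne_zero ?_) (minor_ne_zero ?_))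
    · rw [Ne, Fin.ext_iff]; dsimp only; omega
    · rw [Ne, Fin.ext_iff]; dsimp only; omega
  funext b
  rcases b with b | k | m
  · fin_cases b
    · exact hA0
    · exact hB0
    · exact hG0
  · exact ht0 k
  · exact congrFun hd0 m

theorem det_coeffMatrix_ne_zero (hn : 3 ≤ n)
    (e : (Fin n ⊕ Fin n) ≃ (Fin 3 ⊕ Fin n ⊕ Fin (n - 3))) :
    ((coeffMatrix hn).submatrix id e).det ≠ 0 := by
  intro h0
  obtain ⟨v, hv, hMv⟩ := Matrix.exists_mulVec_eq_zero_iff.2 h0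
  have hc : v ∘ e.symm = 0 := by
    refine eq_zero_of_sum_mul_basisField_eq_zero hn fun w => ?_
    have := congrFun hMv w
    rw [← e.sum_comp]
    simpa [Matrix.mulVec, dotProduct, coeffMatrix, mul_comm] using this
  refine hv (funext fun i => ?_)
  simpa using congrFun hc (e i)

theorem exists_det_coeffMatrix_eq (hn : 3 ≤ n)
    (e : (Fin n ⊕ Fin n) ≃ (Fin 3 ⊕ Fin n ⊕ Fin (n - 3))) :
    ∃ c : ℂ, c ≠ 0 ∧ ((coeffMatrix hn).submatrix id e).det =
      C c * arrangementPoly (⊤ : SimpleGraph (Fin n)) := by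
  have hne := det_coeffMatrix_ne_zero hn e
  have hhom := isHomogeneous_det_coeffMatrix hn e
  obtain ⟨q, hq⟩ : arrangementPoly (⊤ : SimpleGraph (Fin n)) ∣
      ((coeffMatrix hn).submatrix id e).det :=
    arrangementPoly_top_dvd_det (fun i => basisField hn (e i))
      fun i => basisField_mem_logDer hn (e i)
  have hf : arrangementPoly (⊤ : SimpleGraph (Fin n)) ≠ 0 := arrangementPoly_top_ne_zero
  rw [hq] at hne hhom
  have hq0 : q ≠ 0 := right_ne_zero_of_mul hne
  have hdeg := hhom.totalDegree hne
  rw [totalDegree_mul_of_isDomain hf hq0, isHomogeneous_arrangementPoly_top.totalDegree hf] at hdeg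
  -- The determinant and `f` have the same degree, so the quotient is constant.
  have hqC := totalDegree_eq_zero_iff_eq_C.1 (show q.totalDegree = 0 by omega)
  refine ⟨coeff 0 q, fun h => hq0 ?_, ?_⟩
  · rw [hqC, h, C_0]
  · rw [hq, ← hqC, mul_comm]

end DetArr

end

theorem theorem3p3 (n : ℕ) (hn : 3 ≤ n) :
    -- the determinantal arrangement of the complete graph is free
    DetArr.IsFreeDivisor (DetArr.arrangementPoly (⊤ : SimpleGraph (Fin n))) ∧
    -- the explicit fields form a basis of `Der(-log f)`
    (∃ b : Module.Basis (Fin 3 ⊕ Fin n ⊕ Fin (n - 3)) (DetArr.CoordRing n)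
        (DetArr.logDer (DetArr.arrangementPoly (⊤ : SimpleGraph (Fin n)))),
      ∀ i, (b i : DetArr.VectorField n) = DetArr.basisField hn i) ∧
    -- degrees: `α, β, γ, θₖ` are linear, the `φₘ` have degree `n + 1`
    DetArr.IsHomogeneousField (DetArr.α n) 1 ∧
    DetArr.IsHomogeneousField (DetArr.β n) 1 ∧
    DetArr.IsHomogeneousField (DetArr.γ n) 1 ∧
    (∀ k : Fin n, DetArr.IsHomogeneousField (DetArr.θ k) 1) ∧
    (∀ m : Fin (n - 3), DetArr.IsHomogeneousField (DetArr.φ hn m.val) (n + 1)) ∧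
    -- Saito's determinant is a nonzero constant multiple of `f`, for an ordering of the fields
    (∃ (e : (Fin n ⊕ Fin n) ≃ (Fin 3 ⊕ Fin n ⊕ Fin (n - 3))) (c : ℂ), c ≠ 0 ∧
      ((DetArr.coeffMatrix hn).submatrix id e).det =
        MvPolynomial.C c * DetArr.arrangementPoly (⊤ : SimpleGraph (Fin n))) := by
  -- Any ordering serves: reordering the fields only changes the sign of the determinant.
  have e : (Fin n ⊕ Fin n) ≃ (Fin 3 ⊕ Fin n ⊕ Fin (n - 3)) :=
    Fintype.equivOfCardEq (by simp only [Fintype.card_sum, Fintype.card_fin]; omega)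
  obtain ⟨c, hc, hdet⟩ := DetArr.exists_det_coeffMatrix_eq hn e
  obtain ⟨b, hb⟩ := DetArr.exists_basis_logDer e (DetArr.basisField hn)
    (DetArr.basisField_mem_logDer hn) hc hdet
  exact ⟨⟨DetArr.arrangementPoly_top_ne_zero, Module.Free.of_basis b⟩, ⟨b, hb⟩,
    DetArr.isHomogeneousField_α, DetArr.isHomogeneousField_β, DetArr.isHomogeneousField_γ,
    DetArr.isHomogeneousField_θ, fun m => DetArr.isHomogeneousField_φ hn m.val,
    e, c, hc, hdet⟩
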